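/- For positive integers $n,d$ let $[n]=\{1,\dots,n\}$. A \emph{proper brick} in $[n]^d$ is a set $B=B_1\times\cdots\times B_d$ in which every $B_i$ is a nonempty interval $\{a_i,a_i+1,\dots,b_i\}\subseteq[n]$ with $B_i\neq[n]$. An \emph{axis-parallel line} in $[n]^d$ is a set obtained by fixing all but one of the coordinates and letting the remaining one range over $[n]$. A partition of $[n]^d$ has the \emph{$k$-piercing property} if every axis-parallel line intersects at least $k$ distinct parts of the partition. \textbf{Theorem.} Let $k\ge 2$ and $d\ge 1$ be integers. Then there is an $N=N(k,d)$ such that for every $n\ge N$ there exists a partition $\{B^1,\dots,B^m\}$ of $[n]^d$ into proper bricks having the $k$-piercing property with $m\le 3.92^{d}\,k$. -/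

import Mathlib

/-- `Grid n d` is the discrete cube `[n]^d`, with `Fin n` in the role of `[n] = {1, …, n}`. -/
abbrev Grid (n d : ℕ) : Type := Fin d → Fin n

/-- `B` is a proper box in `[n]^d`: a product `B₁ × ⋯ × B_d` in which every side `Bᵢ` is a
nonempty proper subset of `[n]`. -/
def IsProperBox {n d : ℕ} (B : Finset (Grid n d)) : Prop :=
  ∃ S : Fin d → Finset (Fin n),
    (∀ i, (S i).Nonempty ∧ S i ≠ Finset.univ) ∧ B = Fintype.piFinset S

/-- `B` is a brick in `[n]^d`: a product of nonempty intervals `{aᵢ, aᵢ + 1, …, bᵢ}`. -/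
def IsBrick {n d : ℕ} (B : Finset (Grid n d)) : Prop :=
  ∃ a b : Grid n d, (∀ i, a i ≤ b i) ∧ B = Fintype.piFinset (fun i => Finset.Icc (a i) (b i))

/-- The axis-parallel line in direction `i` through the point `x`: all points that agree with `x`
in every coordinate other than `i`. -/
def axisLine {n d : ℕ} (i : Fin d) (x : Grid n d) : Finset (Grid n d) :=
  {y | ∀ j, j ≠ i → y j = x j}

/-- The `k`-piercing property of a partition of `[n]^d`: every axis-parallel line meets at least
`k` distinct parts. -/
def IsPiercing {n d : ℕ} (k : ℕ) (P : Finpartition (Finset.univ : Finset (Grid n d))) : Prop :=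
  ∀ (i : Fin d) (x : Grid n d), k ≤ (P.parts.filter fun B => (B ∩ axisLine i x).Nonempty).card

/-! Bricks multiply under a composition. Take a directed partition of `[q]^s` into `M` bricks, blow
each cell coordinate up into a long block, and cross with `d` further coordinates. Inside brick `j`,
refine by a `k`-piercing partition in `d + 1` dimensions, read off from the coordinate `c j` and the
`d` further ones. A line in one of the `d` directions stays inside one brick and is pierced there; a
line in direction `i` of the first `s` is pierced inside a brick with `c j = i`. So `s - 1` extra
dimensions cost a factor `M` (`IsDirectedPartition.isPiercingLabeling`).

A 15-brick directed partition of `[4]^3` costs 15 per two dimensions, and `15 < 3.92 ^ 2`. Starting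
from `k` intervals in dimension 1 this settles odd `d`; one use of a 4-brick partition of `[2]^2`
gives even `d`. -/

/-- A labeling of a finite grid whose nonempty fibres are bricks, expressed as closure of every
fibre under passing to the box spanned by two of its points, and such that every axis-parallel line
sees at least `k` labels. -/
structure IsPiercingLabeling {ι L : Type*} [DecidableEq ι] {n : ℕ} (k : ℕ)
    (f : (ι → Fin n) → L) : Prop where
  convex : ∀ x y z, f x = f y → (∀ i, z i ∈ Set.uIcc (x i) (y i)) → f z = f x
  piercing : ∀ i x, k ≤ (Set.range fun t => f (Function.update x i t)).ncard

/-- A partition of `[q]^s` into bricks labelled by `C`, each brick `j` being assigned a direction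
`c j`, such that every axis-parallel line meets a brick assigned to its own direction. The side of
the brick `j` in its direction contains `r j`. -/
structure IsDirectedPartition {s q : ℕ} {C : Type*} (g : (Fin s → Fin q) → C) (c : C → Fin s)
    (r : C → Fin q) : Prop where
  convex : ∀ x y z, g x = g y → (∀ i, z i ∈ Set.uIcc (x i) (y i)) → g z = g x
  directed : ∀ i u, ∃ t, c (g (Function.update u i t)) = i
  rep : ∀ u, g (Function.update u (c (g u)) (r (g u))) = g u

/-- For all large `n`, the grid `[n]^d` has a `k`-piercing partition into at most `m` bricks. -/
def HasPiercingLabeling (k d m : ℕ) : Prop :=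
  ∃ N : ℕ, 0 < N ∧ ∀ n, N ≤ n → ∃ f : (Fin d → Fin n) → Fin m, IsPiercingLabeling k f

/-! ### Composing directed partitions with piercing labelings -/

lemma IsPiercingLabeling.relabel {ι L L' : Type*} [DecidableEq ι] {n k : ℕ}
    {f : (ι → Fin n) → L} (hf : IsPiercingLabeling k f) {e : L → L'}
    (he : Function.Injective e) : IsPiercingLabeling k (e ∘ f) where
  convex x y z hxy hz := congrArg e (hf.convex x y z (he hxy) hz)
  piercing i x := by
    have h : (Set.range fun t => (e ∘ f) (Function.update x i t))
        = e '' Set.range fun t => f (Function.update x i t) := by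
      rw [← Set.range_comp]; rfl
    rw [h, Set.ncard_image_of_injective _ he]
    exact hf.piercing i x

lemma IsPiercingLabeling.reindex {ι κ L : Type*} [DecidableEq ι] [DecidableEq κ] {n k : ℕ}
    {f : (ι → Fin n) → L} (hf : IsPiercingLabeling k f) (e : ι ≃ κ) :
    IsPiercingLabeling k (fun x : κ → Fin n => f (x ∘ e)) where
  convex x y z hxy hz := hf.convex _ _ _ hxy fun i => hz (e i)
  piercing i x := by
    obtain ⟨j, rfl⟩ := e.surjective i
    simpa only [Function.update_comp_equiv, Equiv.symm_apply_apply] using hf.piercing j (x ∘ e)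

lemma exists_monotone_blocks {q N n : ℕ} (hq : 0 < q) (hN : 0 < N) (hn : q * N ≤ n) :
    ∃ (b : Fin n → Fin q) (φ : Fin q → Fin n → Fin N), Monotone b ∧ (∀ r, Monotone (φ r)) ∧
      ∀ r s, ∃ t, b t = r ∧ φ r t = s := by
  -- The last block absorbs the remainder of `n`; each `φ r` climbs through `[N]` on block `r` and
  -- is constant elsewhere.
  refine ⟨fun t => ⟨min (t / N) (q - 1), by omega⟩,
    fun r t => ⟨min (t - r * N) (N - 1), by omega⟩, ?_, ?_, ?_⟩
  · intro x y h
    exact Fin.mk_le_mk.2 (min_le_min_right _ (Nat.div_le_div_right h))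
  · intro r x y h
    exact Fin.mk_le_mk.2 (min_le_min_right _ (Nat.sub_le_sub_right h _))
  · intro r s
    have hlt : (r : ℕ) * N + s < q * N :=
      calc (r : ℕ) * N + s < r * N + N := by omega
        _ = (r + 1) * N := by ring
        _ ≤ q * N := Nat.mul_le_mul_right _ r.2
    refine ⟨⟨r * N + s, hlt.trans_le hn⟩, ?_, ?_⟩
    · have : ((r : ℕ) * N + s) / N = r := by
        rw [mul_comm, Nat.mul_add_div hN, Nat.div_eq_of_lt s.2, add_zero]
      ext
      simp only [this]
      omega
    · ext
      simp only [Nat.add_sub_cancel_left]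
      omega

lemma Monotone.apply_mem_uIcc {α β : Type*} [LinearOrder α] [LinearOrder β] {f : α → β}
    (hf : Monotone f) {x y z : α} (hz : z ∈ Set.uIcc x y) : f z ∈ Set.uIcc (f x) (f y) :=
  hf.mapsTo_uIcc hz

/-- The composition of a directed partition of `[q]^s` with a piercing labeling: inside the brick
`j`, the labeling is applied to the coordinate `c j` and the remaining `d` coordinates. -/
lemma IsDirectedPartition.isPiercingLabeling {s q d N n k : ℕ} {C L : Type*} [Finite C] [Finite L]
    {g : (Fin s → Fin q) → C} {c : C → Fin s} {r : C → Fin q} (hg : IsDirectedPartition g c r)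
    {f : (Fin (d + 1) → Fin N) → L} (hf : IsPiercingLabeling k f)
    {b : Fin n → Fin q} {φ : Fin q → Fin n → Fin N} (hb : Monotone b)
    (hφ : ∀ r, Monotone (φ r)) (hbφ : ∀ r s, ∃ t, b t = r ∧ φ r t = s) :
    IsPiercingLabeling k (fun x : Fin s ⊕ Fin d → Fin n =>
      (g (fun i => b (x (.inl i))),
        f (Fin.cons
          (φ (r (g fun i => b (x (.inl i)))) (x (.inl (c (g fun i => b (x (.inl i)))))))
          fun i => φ (r (g fun i => b (x (.inl i)))) (x (.inr i))))) where
  convex x y z hxy hz := by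
    obtain ⟨h₁, h₂⟩ := Prod.mk.inj hxy
    have h₃ := hg.convex _ _ (fun i => b (z (.inl i))) h₁ fun i => hb.apply_mem_uIcc (hz _)
    rw [← h₁] at h₂
    refine Prod.ext h₃ ?_
    simp only [h₃]
    refine hf.convex _ _ _ h₂ fun i => ?_
    cases i using Fin.cases with
    | zero => simpa using (hφ _).apply_mem_uIcc (hz _)
    | succ i => simpa using (hφ _).apply_mem_uIcc (hz _)
  piercing i x := by
    have key : ∀ (j : C) (l : Fin (d + 1)) (w : Fin (d + 1) → Fin N) (S : Set (C × L)),
        (∀ a, (j, f (Function.update w l a)) ∈ S) → k ≤ S.ncard := by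
      intro j l w S hS
      refine (hf.piercing l w).trans ?_
      rw [← Set.ncard_image_of_injective _ (Prod.mk_right_injective j)]
      refine Set.ncard_le_ncard ?_ (Set.toFinite _)
      rintro _ ⟨_, ⟨a, rfl⟩, rfl⟩
      exact hS a
    rcases i with i | i
    · obtain ⟨t, ht⟩ := hg.directed i fun i => b (x (.inl i))
      set j := g (Function.update (fun i => b (x (.inl i))) i t) with hj
      -- By `rep`, the line meets brick `j` throughout block `r j`, where `φ (r j)` takes every
      -- value.
      have hr : g (Function.update (fun i => b (x (.inl i))) i (r j)) = j := by
        have := hg.rep (Function.update (fun i => b (x (.inl i))) i t)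
        rwa [← hj, ht, Function.update_idem] at this
      refine key j 0 (Fin.cons (φ (r j) (x (.inl i))) fun i => φ (r j) (x (.inr i))) _ fun a => ?_
      obtain ⟨u, hu, hu'⟩ := hbφ (r j) a
      refine ⟨u, ?_⟩
      have hbu : (fun i' => b (Function.update x (.inl i) u (.inl i')))
          = Function.update (fun i => b (x (.inl i))) i (r j) := by
        ext i'
        by_cases h : i' = i
        · subst h; simp [hu]
        · simp [h]
      simp only [hbu, hr, ht, Function.update_self, hu', Fin.update_cons_zero, ne_eq, reduceCtorEq,
        not_false_eq_true, Function.update_of_ne]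
    · set j := g fun i => b (x (.inl i)) with hj
      refine key j i.succ (Fin.cons (φ (r j) (x (.inl (c j)))) fun i => φ (r j) (x (.inr i))) _
        fun a => ?_
      obtain ⟨u, hu, hu'⟩ := hbφ (r j) a
      refine ⟨u, ?_⟩
      have hφu : (fun i' => φ (r j) (Function.update x (.inr i) u (.inr i')))
          = Function.update (fun i => φ (r j) (x (.inr i))) i a := by
        ext i'
        by_cases h : i' = i
        · subst h; simp [hu']
        · simp [h]
      simp only [ne_eq, reduceCtorEq, not_false_eq_true, Function.update_of_ne, ← hj, hφu,
        Fin.cons_update]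

lemma HasPiercingLabeling.of_directedPartition {s q M k d m : ℕ} (hq : 0 < q)
    {g : (Fin s → Fin q) → Fin M} {c : Fin M → Fin s} {r : Fin M → Fin q}
    (hg : IsDirectedPartition g c r) (h : HasPiercingLabeling k (d + 1) m) :
    HasPiercingLabeling k (s + d) (M * m) := by
  obtain ⟨N, hN, h⟩ := h
  obtain ⟨f, hf⟩ := h N le_rfl
  refine ⟨q * N, Nat.mul_pos hq hN, fun n hn => ?_⟩
  obtain ⟨b, φ, hb, hφ, hbφ⟩ := exists_monotone_blocks hq hN hn
  exact ⟨_, ((hg.isPiercingLabeling hf hb hφ hbφ).relabel finProdFinEquiv.injective).reindex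
    finSumFinEquiv⟩

/-! ### Explicit directed partitions -/

/-- Reduces a directed partition to finite conditions on brick corners, decidable for concrete data.
The representative `r j` is the lower end of the side in direction `c j`. -/
lemma exists_isDirectedPartition {s q M : ℕ} (lo hi : Fin M → Fin s → Fin q) (c : Fin M → Fin s)
    (hle : ∀ j i, lo j i ≤ hi j i)
    (hcover : ∀ u : Fin s → Fin q, ∃ j, ∀ i, lo j i ≤ u i ∧ u i ≤ hi j i)
    (hdisj : ∀ j j', j ≠ j' → ∃ i, hi j i < lo j' i ∨ hi j' i < lo j i)
    (hdir : ∀ i u, ∃ t j, c j = i ∧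
      ∀ i', lo j i' ≤ Function.update u i t i' ∧ Function.update u i t i' ≤ hi j i') :
    ∃ (g : (Fin s → Fin q) → Fin M) (r : Fin M → Fin q), IsDirectedPartition g c r := by
  simp only [forall_and, ← Pi.le_def] at hcover hdir
  choose g hg using hcover
  have huniq : ∀ u j, lo j ≤ u → u ≤ hi j → g u = j := by
    intro u j h₁ h₂
    by_contra h
    obtain ⟨i, hi | hi⟩ := hdisj _ _ h
    · exact absurd (((h₁ i).trans ((hg u).2 i)).trans_lt hi) (lt_irrefl _)
    · exact absurd ((((hg u).1 i).trans (h₂ i)).trans_lt hi) (lt_irrefl _)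
  refine ⟨g, fun j => lo j (c j), ?_, ?_, ?_⟩
  · intro x y z hxy hz
    refine huniq z _ (fun i => ?_) fun i => ?_
    · exact (le_inf ((hg x).1 i) (hxy ▸ (hg y).1 i)).trans (hz i).1
    · exact (hz i).2.trans (sup_le ((hg x).2 i) (hxy ▸ (hg y).2 i))
  · intro i u
    obtain ⟨t, j, hc, h₁, h₂⟩ := hdir i u
    exact ⟨t, by rw [huniq _ j h₁ h₂, hc]⟩
  · intro u
    refine huniq _ _ ?_ ?_
    · exact le_update_iff.2 ⟨le_rfl, fun i _ => (hg u).1 i⟩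
    · exact update_le_iff.2 ⟨hle _ _, fun i _ => (hg u).2 i⟩

lemma exists_isDirectedPartition_two :
    ∃ (g : (Fin 2 → Fin 2) → Fin 4) (c : Fin 4 → Fin 2) (r : Fin 4 → Fin 2),
      IsDirectedPartition g c r := by
  obtain ⟨g, r, h⟩ := exists_isDirectedPartition (s := 2) (q := 2) (M := 4)
    ![![0, 0], ![0, 1], ![1, 0], ![1, 1]] ![![0, 0], ![0, 1], ![1, 0], ![1, 1]] ![0, 1, 1, 0]
    (by decide +kernel) (by decide +kernel) (by decide +kernel) (by decide +kernel)
  exact ⟨g, _, r, h⟩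

lemma exists_isDirectedPartition_three :
    ∃ (g : (Fin 3 → Fin 4) → Fin 15) (c : Fin 15 → Fin 3) (r : Fin 15 → Fin 4),
      IsDirectedPartition g c r := by
  obtain ⟨g, r, h⟩ := exists_isDirectedPartition (s := 3) (q := 4) (M := 15)
    ![![0, 0, 0], ![0, 0, 2], ![0, 0, 3], ![0, 2, 3], ![0, 3, 0], ![1, 0, 0], ![1, 0, 2],
      ![1, 1, 2], ![1, 1, 3], ![1, 2, 0], ![1, 3, 0], ![2, 1, 2], ![2, 2, 2], ![2, 2, 3],
      ![3, 0, 2]]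
    ![![0, 2, 1], ![0, 2, 2], ![0, 1, 3], ![1, 3, 3], ![0, 3, 2], ![3, 1, 1], ![2, 0, 3],
      ![1, 3, 2], ![1, 1, 3], ![3, 2, 1], ![3, 3, 1], ![3, 1, 3], ![3, 3, 2], ![3, 3, 3],
      ![3, 0, 3]]
    ![0, 2, 1, 2, 1, 2, 1, 0, 0, 1, 0, 1, 2, 0, 0]
    (by decide +kernel) (by decide +kernel) (by decide +kernel) (by decide +kernel)
  exact ⟨g, _, r, h⟩

/-! ### Counting bricks -/

lemma hasPiercingLabeling_one {k : ℕ} (hk : 0 < k) : HasPiercingLabeling k 1 k := by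
  refine ⟨k, hk, fun n hn => ?_⟩
  have hmono : Monotone fun t : Fin n => (⟨min t (k - 1), by omega⟩ : Fin k) := fun x y h =>
    Fin.mk_le_mk.2 (min_le_min_right _ h)
  refine ⟨fun x => ⟨min (x 0) (k - 1), by omega⟩, ?_, ?_⟩
  · intro x y z hxy hz
    have := hmono.apply_mem_uIcc (hz 0)
    beta_reduce at this hxy
    rwa [← hxy, Set.uIcc_self] at this
  · intro i x
    obtain rfl := Subsingleton.elim i 0
    have : (Set.range fun t : Fin n =>
        (⟨min (Function.update x 0 t 0 : Fin n) (k - 1), by omega⟩ : Fin k)) = Set.univ := by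
      refine Set.eq_univ_of_forall fun s => ⟨⟨s, by omega⟩, ?_⟩
      ext
      simp only [Function.update_self]
      omega
    rw [this, Set.ncard_univ, Nat.card_fin]

lemma hasPiercingLabeling_odd {k : ℕ} (hk : 0 < k) (a : ℕ) :
    HasPiercingLabeling k (2 * a + 1) (15 ^ a * k) := by
  induction a with
  | zero => simpa using hasPiercingLabeling_one hk
  | succ a ih =>
    obtain ⟨g, c, r, h⟩ := exists_isDirectedPartition_three
    have := ih.of_directedPartition (by norm_num) h
    rwa [← mul_assoc, ← pow_succ', show 3 + 2 * a = 2 * (a + 1) + 1 by ring] at this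

lemma hasPiercingLabeling_even {k : ℕ} (hk : 0 < k) (a : ℕ) :
    HasPiercingLabeling k (2 * a + 2) (4 * (15 ^ a * k)) := by
  obtain ⟨g, c, r, h⟩ := exists_isDirectedPartition_two
  have := (hasPiercingLabeling_odd hk a).of_directedPartition (by norm_num) h
  rwa [add_comm] at this

lemma exists_hasPiercingLabeling {k d : ℕ} (hk : 0 < k) (hd : 1 ≤ d) :
    ∃ m : ℕ, HasPiercingLabeling k d m ∧ (m : ℝ) ≤ (3.92 : ℝ) ^ d * (k : ℝ) := by
  have hpow : ∀ a : ℕ, (15 : ℝ) ^ a ≤ (3.92 : ℝ) ^ (2 * a) := fun a => by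
    rw [pow_mul]
    exact pow_le_pow_left₀ (by norm_num) (by norm_num) a
  obtain ⟨a, rfl | rfl⟩ : ∃ a, d = 2 * a + 1 ∨ d = 2 * a + 2 := ⟨(d - 1) / 2, by omega⟩
  · refine ⟨_, hasPiercingLabeling_odd hk a, ?_⟩
    push_cast
    gcongr
    rw [pow_succ]
    nlinarith [hpow a, pow_pos (show (0 : ℝ) < 15 by norm_num) a]
  · refine ⟨_, hasPiercingLabeling_even hk a, ?_⟩
    push_cast
    rw [← mul_assoc]
    gcongr
    rw [pow_add]
    -- The leftover factor 4 is absorbed by `3.92 ^ 2`.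
    nlinarith [hpow a, pow_pos (show (0 : ℝ) < 15 by norm_num) a]

/-! ### From labelings to partitions into proper bricks -/

/-- A nonempty fibre of a piercing labeling is a brick. -/
lemma IsPiercingLabeling.exists_fiber_eq_piFinset {n d k : ℕ} {L : Type*} [DecidableEq L]
    {f : Grid n d → L} (hf : IsPiercingLabeling k f) (x : Grid n d) :
    ∃ a b : Grid n d, a ≤ b ∧
      (Finset.univ.filter fun y => f y = f x) = Fintype.piFinset fun i => Finset.Icc (a i) (b i) := by
  set B := Finset.univ.filter fun y => f y = f x
  have hx : x ∈ B := by simp [B]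
  -- Convexity puts the coordinatewise extremes of the fibre in the fibre, so they are opposite
  -- corners of it.
  have hinf : B.inf' ⟨x, hx⟩ id ∈ B := by
    refine Finset.inf'_induction (p := (· ∈ B)) _ _ (fun y hy z hz => ?_) fun y hy => hy
    simp only [B, Finset.mem_filter, Finset.mem_univ, true_and] at hy hz ⊢
    rw [← hy]
    exact hf.convex y z _ (hy.trans hz.symm) fun i =>
      ⟨le_rfl, inf_le_left.trans le_sup_left⟩
  have hsup : B.sup' ⟨x, hx⟩ id ∈ B := by
    refine Finset.sup'_induction (p := (· ∈ B)) _ _ (fun y hy z hz => ?_) fun y hy => hy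
    simp only [B, Finset.mem_filter, Finset.mem_univ, true_and] at hy hz ⊢
    rw [← hy]
    exact hf.convex y z _ (hy.trans hz.symm) fun i =>
      ⟨inf_le_left.trans le_sup_left, le_rfl⟩
  have hle : ∀ y ∈ B, B.inf' ⟨x, hx⟩ id ≤ y := fun y hy => Finset.inf'_le id hy
  have hge : ∀ y ∈ B, y ≤ B.sup' ⟨x, hx⟩ id := fun y hy => Finset.le_sup' id hy
  generalize B.inf' ⟨x, hx⟩ id = a at *
  generalize B.sup' ⟨x, hx⟩ id = b at *
  refine ⟨a, b, hle b hsup, ?_⟩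
  ext y
  simp only [Fintype.mem_piFinset, Finset.mem_Icc]
  refine ⟨fun hy i => ⟨hle y hy i, hge y hy i⟩, fun hy => ?_⟩
  simp only [B, Finset.mem_filter, Finset.mem_univ, true_and] at hinf hsup ⊢
  rw [← hinf]
  exact hf.convex a b y (hinf.trans hsup.symm) fun i => Set.Icc_subset_uIcc (hy i)

/-- A labeling with at most `m` labels gives a partition with at most `m` parts. -/
lemma IsPiercingLabeling.exists_finpartition {n d k m : ℕ} (hk : 2 ≤ k) {f : Grid n d → Fin m}
    (hf : IsPiercingLabeling k f) :
    ∃ P : Finpartition (Finset.univ : Finset (Grid n d)),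
      (∀ B ∈ P.parts, IsProperBox B ∧ IsBrick B) ∧ IsPiercing k P ∧ P.parts.card ≤ m := by
  classical
  let fiber : Fin m → Finset (Grid n d) := fun l => Finset.univ.filter fun y => f y = l
  have hfiber : ∀ y l, y ∈ fiber l ↔ f y = l := fun y l => by simp [fiber]
  have hparts : ∀ B, B ∈ (Finpartition.ofSetoid (Setoid.ker f)).parts ↔ ∃ x, fiber (f x) = B := by
    intro B
    simp only [Finpartition.ofSetoid, Finpartition.ofSetSetoid, Finset.mem_image, Finset.mem_univ,
      true_and]
    refine exists_congr fun x => Eq.congr_left ?_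
    ext y
    simp [hfiber, Setoid.ker_def, eq_comm]
  refine ⟨Finpartition.ofSetoid (Setoid.ker f), fun B hB => ?_, fun i x => ?_, ?_⟩
  · obtain ⟨x, rfl⟩ := (hparts B).1 hB
    obtain ⟨a, b, hab, hB⟩ := hf.exists_fiber_eq_piFinset x
    refine ⟨⟨_, fun i => ⟨Finset.nonempty_Icc.2 (hab i), fun huniv => ?_⟩, hB⟩, a, b, hab, hB⟩
    -- A full side would contain a line with a single label, against `2 ≤ k`.
    have hline : ∀ t, f (Function.update x i t) = f x := by
      intro t
      rw [← hfiber]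
      change _ ∈ Finset.univ.filter fun y => f y = f x
      have hx : x ∈ Finset.univ.filter fun y => f y = f x := by simp
      rw [hB, Fintype.mem_piFinset] at hx ⊢
      intro i'
      by_cases h : i' = i
      · subst h
        rw [huniv]
        exact Finset.mem_univ _
      · simpa [h] using hx i'
    have hp := hf.piercing i x
    have : Nonempty (Fin n) := ⟨x i⟩
    simp only [hline, Set.range_const, Set.ncard_singleton] at hp
    omega
  · refine (hf.piercing i x).trans ?_
    rw [← Set.ncard_coe_finset]
    refine Set.ncard_le_ncard_of_injOn fiber ?_ ?_ (Finset.finite_toSet _)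
    · rintro _ ⟨t, rfl⟩
      rw [Finset.mem_coe, Finset.mem_filter]
      refine ⟨(hparts _).2 ⟨_, rfl⟩, Function.update x i t, ?_⟩
      simp +contextual [hfiber, axisLine]
    · rintro _ ⟨t, rfl⟩ l _ h
      rw [← hfiber, ← h, hfiber]
  · calc _ ≤ (Finset.univ.image fiber).card := Finset.card_le_card fun B hB => by
          obtain ⟨x, rfl⟩ := (hparts B).1 hB
          exact Finset.mem_image_of_mem _ (Finset.mem_univ _)
      _ ≤ m := Finset.card_image_le.trans (by simp)

theorem theorem5 (k d : ℕ) (hk : 2 ≤ k) (hd : 1 ≤ d) :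
    ∃ N : ℕ, ∀ n : ℕ, N ≤ n →
      ∃ P : Finpartition (Finset.univ : Finset (Grid n d)),
        (∀ B ∈ P.parts, IsProperBox B ∧ IsBrick B) ∧
        IsPiercing k P ∧
        (P.parts.card : ℝ) ≤ (3.92 : ℝ) ^ d * (k : ℝ) := by
  obtain ⟨m, ⟨N, -, hN⟩, hm⟩ := exists_hasPiercingLabeling (k := k) (by omega) hd
  refine ⟨N, fun n hn => ?_⟩
  obtain ⟨f, hf⟩ := hN n hn
  obtain ⟨P, hP, hpierce, hcard⟩ := hf.exists_finpartition hk
  exact ⟨P, hP, hpierce, (Nat.cast_le.2 hcard).trans hm⟩
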